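/- Let $X_n$ be a finite-dimensional simple Lie algebra over $\mathbb{C}$ with simple roots $\alpha_1,\dots,\alpha_n$ (with respect to any Cartan subalgebra and any base), and let $(\cdot|\cdot)$ be the invariant bilinear form normalized by $(\alpha|\alpha)=2$ for a long root $\alpha$. Put $t_a=2/(\alpha_a|\alpha_a)$, $H=\{(a,m): 1\le a\le n,\ m\ge 1\}$, and for $(a,m),(b,k)\in H$ $$B_{am,bk}=2\min(t_bm,t_ak)-\min(t_bm,t_a(k+1))-\min(t_bm,t_a(k-1)).$$ For each $(a,m)\in H$ only finitely many $B_{am,bk}$ are non-zero, and all $(\alpha_a|\alpha_b)B_{am,bk}$ are integers. Let $\mathcal N$ be the set of finitely supported families $N=(N_m^{(a)})_{(a,m)\in H}$ of non-negative integers. For $\nu,N\in\mathcal N$ put $$P_m^{(a)}=\sum_{k\ge1}\min(m,k)\,\nu_k^{(a)}-\sum_{(b,k)\in H}(\alpha_a|\alpha_b)\min(t_bm,t_ak)\,N_k^{(b)},$$ $$F_{am,bk}=\delta_{ab}\delta_{mk}P_m^{(a)}+(\alpha_a|\alpha_b)\min(t_bm,t_ak)\,N_k^{(b)},$$ $$R(\nu,N)=\Bigl(\det_{(a,m),(b,k)\in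 H'}F_{am,bk}\Bigr)\prod_{(a,m)\in H'}\frac1{N_m^{(a)}}\binom{P_m^{(a)}+N_m^{(a)}-1}{N_m^{(a)}-1},\qquad K(\nu,N)=\prod_{(a,m)\in H}\binom{P_m^{(a)}+N_m^{(a)}}{N_m^{(a)}},$$ where $H'=\{(a,m)\in H: N_m^{(a)}>0\}$, $R(\nu,0)=1$, and $\binom{x}{j}=x(x-1)\cdots(x-j+1)/j!$. Define power series in $y=(y_1,\dots,y_n)$ by $$\tilde R^\nu(y)=\sum_{N\in\mathcal N}R(\nu,N)\prod_{a=1}^n y_a^{\sum_{m}mN_m^{(a)}},\qquad \tilde K^\nu(y)=\sum_{N\in\mathcal N}K(\nu,N)\prod_{a=1}^n y_a^{\sum_{m}mN_m^{(a)}},$$ and let $\tilde R_m^{(a)}=\tilde R^{\nu}$, $\tilde K_m^{(a)}=\tilde K^{\nu}$ for the family $\nu$ with $\nu_m^{(a)}=1$ and all other entries $0$. Theorem. There is exactly one family $(\tilde Q_m^{(a)}(y))_{(a,m)\in H}$ of invertible elements of $\mathbb{C}[[y]]$ such that (Q̃-I) with $\tilde Q_0^{(a)}=1$, for all $(a,m)\in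 H$, $$(\tilde Q_m^{(a)})^2=\tilde Q_{m+1}^{(a)}\tilde Q_{m-1}^{(a)}+y_a^m(\tilde Q_m^{(a)})^2\prod_{(b,k)\in H}(\tilde Q_k^{(b)})^{-(\alpha_a|\alpha_b)B_{am,bk}};$$ (Q̃-II) for every $a$, the limit $\lim_{m\to\infty}\tilde Q_m^{(a)}$ exists in $\mathbb{C}[[y]]$ with its usual formal power series topology (every coefficient is eventually constant). Moreover $\tilde K^0$ is invertible, and for all $(a,m)\in H$ this family is given by $\tilde Q_m^{(a)}=\tilde R_m^{(a)}=\tilde K_m^{(a)}/\tilde K^0$. -/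

import Mathlib

/-! ### The normalized inner products of the simple roots -/

namespace RootPairing

section NormalizedForm

variable {ι M N : Type*} [AddCommGroup M] [Module ℂ M] [AddCommGroup N] [Module ℂ N]
  [Fintype ι] (P : RootPairing ι ℂ M N) [P.IsCrystallographic]

/-- The canonical Weyl-invariant form `P.RootForm` on a pair of roots, `∑ₖ ⟨αᵢ,αₖ^∨⟩⟨αⱼ,αₖ^∨⟩`,
as a rational number. -/
noncomputable def canonicalForm (i j : ι) : ℚ :=
  ∑ k, (P.pairingIn ℤ i k : ℚ) * (P.pairingIn ℤ j k : ℚ)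

theorem canonicalForm_eq_rootForm (i j : ι) :
    (P.canonicalForm i j : ℂ) = P.RootForm (P.root i) (P.root j) := by
  have h : ∀ i j, ((P.pairingIn ℤ i j : ℤ) : ℂ) = P.pairing i j := fun i j => by
    simpa using P.algebraMap_pairingIn ℤ i j
  simp [canonicalForm, RootPairing.rootForm_apply_apply, h]

theorem canonicalForm_self_pos (i : ι) : 0 < P.canonicalForm i i := by
  refine Finset.sum_pos' (fun k _ => mul_self_nonneg _) ⟨i, Finset.mem_univ i, ?_⟩
  simp

/-- The value `(αᵢ|αⱼ)` on two roots of the Weyl-invariant bilinear form normalized so that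
`(α|α) = 2` for a long root `α`: the canonical invariant form divided by half of its maximal
value `(α|α)` over all roots `α`. For an irreducible root system the invariant form is unique up
to a scalar, so this is the standard normalized form. -/
noncomputable def normalizedForm (i j : ι) : ℚ :=
  2 * P.canonicalForm i j /
    Finset.univ.sup' ⟨i, Finset.mem_univ i⟩ (fun k => P.canonicalForm k k)

theorem normalizedForm_self_pos (i : ι) : 0 < P.normalizedForm i i := by
  refine div_pos (mul_pos two_pos (P.canonicalForm_self_pos i)) ?_
  exact (P.canonicalForm_self_pos i).trans_le
    (Finset.le_sup' (fun k => P.canonicalForm k k) (Finset.mem_univ i))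

theorem normalizedForm_self_le_two (i : ι) : P.normalizedForm i i ≤ 2 := by
  have h := Finset.le_sup' (fun k => P.canonicalForm k k) (Finset.mem_univ i)
  rw [normalizedForm, div_le_iff₀ ((P.canonicalForm_self_pos i).trans_le h)]
  linarith

theorem exists_normalizedForm_self_eq_two [Nonempty ι] : ∃ i, P.normalizedForm i i = 2 := by
  obtain ⟨i, -, hi⟩ := Finset.exists_mem_eq_sup' (Finset.univ_nonempty (α := ι))
    (fun k => P.canonicalForm k k)
  refine ⟨i, ?_⟩
  rw [normalizedForm, hi, mul_div_assoc, div_self (P.canonicalForm_self_pos i).ne', mul_one]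

/-- The Gram matrix `((α_a|α_b))` of the simple roots of a base. -/
noncomputable def Base.gram {P : RootPairing ι ℂ M N} [P.IsCrystallographic] (b : P.Base) :
    b.support → b.support → ℚ :=
  fun i j => P.normalizedForm i j

end NormalizedForm

end RootPairing

/-! ### The numbers `R(ν,N)`, `K(ν,N)` and the `Q`-system attached to a Gram matrix

Below `I` is the index set `{1, …, n}` of the simple roots and `g a b = (α_a|α_b)`.
The index set `H` of pairs `(a,m)` with `m ≥ 1` is `I × ℕ+`, and the set `𝓝` of finitely
supported families of non-negative integers on `H` is `I × ℕ+ →₀ ℕ`. -/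

namespace QSystem

variable {I : Type*} (g : I → I → ℚ)

/-- `t_a = 2 / (α_a|α_a)`. -/
def t (a : I) : ℚ := 2 / g a a

/-- `B_{am,bk} = 2 min(t_b m, t_a k) - min(t_b m, t_a (k+1)) - min(t_b m, t_a (k-1))`. -/
def B (s r : I × ℕ+) : ℚ :=
  2 * min (t g r.1 * s.2) (t g s.1 * r.2) - min (t g r.1 * s.2) (t g s.1 * ((r.2 : ℚ) + 1))
    - min (t g r.1 * s.2) (t g s.1 * ((r.2 : ℚ) - 1))

/-- For fixed `(a,m)`, only finitely many `B_{am,bk}` are non-zero. -/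
theorem finite_B_ne_zero [Finite I] (hg : ∀ a, 0 < g a a) (s : I × ℕ+) :
    {r : I × ℕ+ | B g s r ≠ 0}.Finite := by
  have ht : ∀ a, 0 < t g a := fun a => div_pos two_pos (hg a)
  choose n hn using fun a : I => exists_nat_gt (t g a * s.2 / t g s.1 + 1)
  have hfin : (⋃ a : I, (fun k : ℕ+ => (a, k)) '' {k : ℕ+ | (k : ℕ) ≤ n a}).Finite := by
    refine Set.finite_iUnion fun a => Set.Finite.image _ ?_
    exact (Set.finite_Iic (n a)).preimage PNat.coe_injective.injOn
  refine hfin.subset fun r hr => ?_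
  simp only [Set.mem_iUnion, Set.mem_image, Set.mem_ofPred_eq]
  refine ⟨r.1, r.2, ?_, rfl⟩
  by_contra! hlt
  apply hr
  have h1 : (n r.1 : ℚ) < ((r.2 : ℕ) : ℚ) := by exact_mod_cast hlt
  have h2 : t g r.1 * s.2 / t g s.1 < ((r.2 : ℕ) : ℚ) - 1 := by linarith [hn r.1]
  rw [div_lt_iff₀ (ht s.1)] at h2
  have h3 := ht s.1
  unfold B
  rw [min_eq_left (by nlinarith), min_eq_left (by nlinarith), min_eq_left (by nlinarith)]
  ring

/-- `γ_m^{(a)}(ν) = ∑_{k ≥ 1} min(m,k) ν_k^{(a)}`. -/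
noncomputable def gamma (ν : I × ℕ+ →₀ ℕ) (s : I × ℕ+) : ℚ :=
  open Classical in
  ν.sum fun r n => if r.1 = s.1 then (min s.2 r.2 : ℕ+) * (n : ℚ) else 0

/-- `P_m^{(a)}(ν,N) = γ_m^{(a)}(ν) - ∑_{(b,k)} (α_a|α_b) min(t_b m, t_a k) N_k^{(b)}`. -/
noncomputable def vacancy (ν N : I × ℕ+ →₀ ℕ) (s : I × ℕ+) : ℚ :=
  gamma ν s - N.sum fun r n => g s.1 r.1 * min (t g r.1 * s.2) (t g s.1 * r.2) * (n : ℚ)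

/-- The generalized binomial coefficient `x (x-1) ⋯ (x-j+1) / j!`. -/
def binom (x : ℚ) (j : ℕ) : ℚ :=
  (∏ i ∈ Finset.range j, (x - i)) / (j.factorial : ℚ)

/-- `F_{am,bk} = δ_{ab} δ_{mk} P_m^{(a)} + (α_a|α_b) min(t_b m, t_a k) N_k^{(b)}`. -/
noncomputable def Fmat (ν N : I × ℕ+ →₀ ℕ) (s r : I × ℕ+) : ℚ :=
  open Classical in
  (if s = r then vacancy g ν N s else 0)
    + g s.1 r.1 * min (t g r.1 * s.2) (t g s.1 * r.2) * (N r : ℚ)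

/-- The number `R(ν,N)`; determinant and product are over `H'(N) = {(a,m) | N_m^{(a)} > 0}`.
For `N = 0` both are empty and `R(ν,0) = 1`. -/
noncomputable def R (ν N : I × ℕ+ →₀ ℕ) : ℚ :=
  open Classical in
  (Matrix.of fun s r : N.support => Fmat g ν N s r).det *
    ∏ s ∈ N.support, (1 / (N s : ℚ)) * binom (vacancy g ν N s + N s - 1) (N s - 1)

/-- The number `K(ν,N) = ∏_{(a,m) ∈ H} binom(P_m^{(a)} + N_m^{(a)}, N_m^{(a)})`; the factors with
`N_m^{(a)} = 0` are `1`. -/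
noncomputable def K (ν N : I × ℕ+ →₀ ℕ) : ℚ :=
  ∏ s ∈ N.support, binom (vacancy g ν N s + N s) (N s)

/-- The exponent of the monomial `∏_a y_a ^ (∑_m m N_m^{(a)})`. -/
noncomputable def weight (N : I × ℕ+ →₀ ℕ) : I →₀ ℕ :=
  N.sum fun s n => Finsupp.single s.1 ((s.2 : ℕ) * n)

theorem le_weight (N : I × ℕ+ →₀ ℕ) (s : I × ℕ+) : (s.2 : ℕ) * N s ≤ weight N s.1 := by
  classical
  by_cases hs : s ∈ N.support
  · rw [weight, Finsupp.sum, Finsupp.finsetSum_apply]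
    refine le_trans ?_ (Finset.single_le_sum (fun _ _ => Nat.zero_le _) hs)
    simp
  · simp [Finsupp.notMem_support_iff.mp hs]

/-- Only finitely many `N` contribute to a given monomial in `y`. -/
theorem finite_weight_eq [Finite I] (d : I →₀ ℕ) :
    {N : I × ℕ+ →₀ ℕ | weight N = d}.Finite := by
  classical
  have hS : {s : I × ℕ+ | (s.2 : ℕ) ≤ d s.1}.Finite := by
    have : (⋃ a : I, (fun k : ℕ+ => (a, k)) '' {k : ℕ+ | (k : ℕ) ≤ d a}).Finite :=
      Set.finite_iUnion fun a => ((Set.finite_Iic (d a)).preimage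
        PNat.coe_injective.injOn).image _
    refine this.subset fun s hs => ?_
    simp only [Set.mem_iUnion, Set.mem_image, Set.mem_ofPred_eq]
    exact ⟨s.1, s.2, hs, rfl⟩
  let M : I × ℕ+ →₀ ℕ := Finsupp.onFinset hS.toFinset
    (fun s => if (s.2 : ℕ) ≤ d s.1 then d s.1 else 0) (by
      intro s hs
      simp only [Set.Finite.mem_toFinset, Set.mem_ofPred_eq]
      by_contra h
      simp [h] at hs)
  refine (Set.finite_Icc 0 M).subset fun N hN => ⟨zero_le, fun s => ?_⟩
  have h := le_weight N s
  rw [Set.mem_ofPred_eq] at hN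
  rw [hN] at h
  simp only [M, Finsupp.onFinset_apply]
  rcases Nat.eq_zero_or_pos (N s) with h0 | h0
  · simp [h0]
  · have hp : 0 < (s.2 : ℕ) := s.2.pos
    rw [if_pos (by nlinarith)]
    nlinarith

/-- The power series `∑_{N ∈ 𝓝} c(N) ∏_a y_a ^ (∑_m m N_m^{(a)})`, i.e. the generating series
`∑_N c(N) w^N` specialized at `w_m^{(a)} = y_a ^ m`. -/
noncomputable def specializedSeries [Finite I] (c : (I × ℕ+ →₀ ℕ) → ℚ) : MvPowerSeries I ℂ :=
  fun d => ((∑ N ∈ (finite_weight_eq d).toFinset, c N : ℚ) : ℂ)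

/-- `R̃^ν(y)`. -/
noncomputable def Rtilde [Finite I] (ν : I × ℕ+ →₀ ℕ) : MvPowerSeries I ℂ :=
  specializedSeries (R g ν)

/-- `K̃^ν(y)`. The series `R̃_m^{(a)}`, `K̃_m^{(a)}` are the case `ν = Finsupp.single (a, m) 1`. -/
noncomputable def Ktilde [Finite I] (ν : I × ℕ+ →₀ ℕ) : MvPowerSeries I ℂ :=
  specializedSeries (K g ν)

/-- A family `Q̃_m^{(a)}`, `m ≥ 1`, of invertible power series extended by `Q̃_0^{(a)} = 1`. -/
def extend {G : Type*} [One G] (Q : I × ℕ+ → G) (a : I) (m : ℕ) : G :=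
  if h : 0 < m then Q (a, ⟨m, h⟩) else 1

/-- The `Q`-system
`(Q̃_m^{(a)})² = Q̃_{m+1}^{(a)} Q̃_{m-1}^{(a)}
  + y_a^m (Q̃_m^{(a)})² ∏_{(b,k)} (Q̃_k^{(b)})^{-(α_a|α_b) B_{am,bk}}` for all `(a,m)`.
The rational numbers `(α_a|α_b) B_{am,bk}` are integers, which is asserted along with the
equations: `e s r` is the integer `-(α_a|α_b) B_{am,bk}` for `s = (a,m)`, `r = (b,k)`. -/
def IsSolution (Q : I × ℕ+ → (MvPowerSeries I ℂ)ˣ) : Prop :=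
  ∃ e : I × ℕ+ → I × ℕ+ → ℤ,
    (∀ s r, (e s r : ℚ) = -(g s.1 r.1 * B g s r)) ∧
    ∀ (a : I) (m : ℕ+),
      (Q (a, m) : MvPowerSeries I ℂ) ^ 2 =
        (Q (a, m + 1) : MvPowerSeries I ℂ) * ((extend Q a ((m : ℕ) - 1) : (MvPowerSeries I ℂ)ˣ) : MvPowerSeries I ℂ)
        + MvPowerSeries.X a ^ (m : ℕ) * (Q (a, m) : MvPowerSeries I ℂ) ^ 2
          * ((∏ᶠ r : I × ℕ+, Q r ^ e (a, m) r : (MvPowerSeries I ℂ)ˣ) : MvPowerSeries I ℂ)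

/-- The convergence property: `lim_{m → ∞} Q̃_m^{(a)}` exists in `ℂ[[y]]` for every `a`, in the
usual topology of formal power series (every coefficient is eventually constant). -/
def Converges (Q : I × ℕ+ → (MvPowerSeries I ℂ)ˣ) : Prop :=
  ∀ a : I, ∃ f : MvPowerSeries I ℂ, ∀ d : I →₀ ℕ, ∀ᶠ m : ℕ+ in Filter.atTop,
    MvPowerSeries.coeff d (Q (a, m) : MvPowerSeries I ℂ) = MvPowerSeries.coeff d f

end QSystem

namespace QSystem

/-! ### Coefficient families satisfying the Pascal recurrence -/

section Pascal

/-! Put `A s r = g s.1 r.1 * min (t g r.1 * s.2) (t g s.1 * r.2)`, an integer matrix, and let the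
vector `γ(ν)` be replaced by an arbitrary integer vector `γ`, so that `P = γ - A N`. Both
coefficient families then satisfy one Pascal rule: for `K` it is Pascal's triangle in a single
factor, for `R` multilinearity of the determinant in a single column (`isPascal_kCoeff`,
`isPascal_rCoeff`). Summed over `N` it reads `F γ = F (γ - e_s) + y_a ^ m * F (γ - A_s)`, with `s =
(a,m)` and `A_s` the column of `A`.

The factor `y_a ^ m` makes this recurrence rigid: a solution is determined by `F 0`
(`IsPascalSeries.eq_zero`). Hence `F 0 = 1` forces `F (γ + δ) = F γ * F δ`. Since `R` has value `1`
at `γ = 0`, its series is multiplicative in `γ`, and the series of `K` is its own value at `0` times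
that of `R`.

The vectors `minVec a m` have second difference `-e_(a,m)` in `m`, and `A_s` is the combination of
them with weights `g * B`. So the recurrence at `γ = 2 * minVec a m` is exactly the `Q`-system, and
convergence holds because a coefficient of `F γ` sees finitely many entries of `γ`.

Uniqueness goes by induction on the degree: two solutions agreeing below degree `n` have quotients
`u_m` that satisfy `u_m ^ 2 = u_(m+1) * u_(m-1)` modulo degree `n + 1`. Then `u_m = u_1 ^ m`, and
convergence forces `u_1 = 1`. -/

theorem binom_zero_right (x : ℚ) : binom x 0 = 1 := by simp [binom]

theorem binom_succ_mul (x : ℚ) (n : ℕ) : binom x (n + 1) * (n + 1) = binom x n * (x - n) := by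
  have h : ((n.factorial : ℕ) : ℚ) ≠ 0 := by exact_mod_cast n.factorial_ne_zero
  have h' : ((n : ℚ) + 1) ≠ 0 := by positivity
  simp only [binom, Finset.prod_range_succ, Nat.factorial_succ]
  push_cast
  field_simp

theorem binom_add_one (x : ℚ) (n : ℕ) : binom (x + 1) (n + 1) = binom x (n + 1) + binom x n := by
  have h : ((n.factorial : ℕ) : ℚ) ≠ 0 := by exact_mod_cast n.factorial_ne_zero
  have h' : ((n : ℚ) + 1) ≠ 0 := by positivity
  have e : ∏ i ∈ Finset.range (n + 1), (x + 1 - (i : ℚ))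
      = (∏ i ∈ Finset.range n, (x - (i : ℚ))) * (x + 1) := by
    rw [Finset.prod_range_succ']
    congr 1
    · refine Finset.prod_congr rfl fun i _ => ?_
      push_cast
      ring
    · simp
  simp only [binom, e, Finset.prod_range_succ, Nat.factorial_succ]
  push_cast
  field_simp
  ring

variable {S : Type*} (A : S → S → ℤ)

/-- The shifted vector `γ - A N`. -/
noncomputable def shifted (γ : S → ℤ) (N : S →₀ ℕ) (s : S) : ℚ :=
  γ s - N.sum fun r n => (A s r : ℚ) * n

/-- Coefficient families `c γ N` that satisfy the Pascal recurrence with shifts by the columns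
of `A`, and such that `c γ N` depends on `γ` only through its restriction to the support of `N`. -/
structure IsPascal [DecidableEq S] (c : (S → ℤ) → (S →₀ ℕ) → ℚ) : Prop where
  congr : ∀ {γ γ' : S → ℤ} {N : S →₀ ℕ}, (∀ s ∈ N.support, γ s = γ' s) → c γ N = c γ' N
  add_single : ∀ γ N s, c γ (N + Finsupp.single s 1) =
    c (γ - Pi.single s 1) (N + Finsupp.single s 1) + c (γ - fun r => A r s) N

variable {A}

theorem shifted_congr {γ γ' : S → ℤ} (N : S →₀ ℕ) {s : S} (h : γ s = γ' s) :
    shifted A γ N s = shifted A γ' N s := by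
  simp [shifted, h]

theorem shifted_sub_single_self [DecidableEq S] (γ : S → ℤ) (N : S →₀ ℕ) (s : S) :
    shifted A (γ - Pi.single s 1) N s = shifted A γ N s - 1 := by
  simp only [shifted, Pi.sub_apply, Pi.single_eq_same]
  push_cast
  ring

theorem shifted_sub_single_of_ne [DecidableEq S] (γ : S → ℤ) (N : S →₀ ℕ) {s r : S}
    (h : r ≠ s) : shifted A (γ - Pi.single s 1) N r = shifted A γ N r :=
  shifted_congr N (by simp [h])

theorem shifted_sub_column (γ : S → ℤ) (N : S →₀ ℕ) (s r : S) :
    shifted A (γ - fun r => A r s) N r = shifted A γ (N + Finsupp.single s 1) r := by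
  classical
  rw [shifted, shifted, Finsupp.sum_add_index (by simp) (by intros; push_cast; ring),
    Finsupp.sum_single_index (by simp)]
  simp only [Pi.sub_apply]
  push_cast
  ring

theorem shifted_sub_column' (γ : S → ℤ) (N : S →₀ ℕ) (s : S) :
    shifted A (γ - fun r => A r s) N = shifted A γ (N + Finsupp.single s 1) :=
  funext fun r => shifted_sub_column γ N s r

theorem support_subset_insert [DecidableEq S] (N : S →₀ ℕ) (s : S) :
    N.support ⊆ insert s N.support := Finset.subset_insert _ _

theorem support_add_single [DecidableEq S] (N : S →₀ ℕ) (s : S) :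
    (N + Finsupp.single s 1).support = insert s N.support := by
  ext r
  by_cases h : r = s
  · subst h; simp
  · simp [h]

variable (A) in
/-- The coefficients `∏ binom(P + N, N)` with `P = γ - A N`. -/
noncomputable def kCoeff (γ : S → ℤ) (N : S →₀ ℕ) : ℚ :=
  ∏ s ∈ N.support, binom (shifted A γ N s + N s) (N s)

theorem kCoeff_eq_prod_of_subset (γ : S → ℤ) (N : S →₀ ℕ) {T : Finset S} (h : N.support ⊆ T) :
    kCoeff A γ N = ∏ s ∈ T, binom (shifted A γ N s + N s) (N s) := by
  refine Finset.prod_subset h fun s _ hs => ?_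
  rw [Finsupp.notMem_support_iff.mp hs, binom_zero_right]

theorem isPascal_kCoeff [DecidableEq S] : IsPascal A (kCoeff A) where
  congr {γ γ' N} h := Finset.prod_congr rfl fun s hs => by rw [shifted_congr N (h s hs)]
  add_single γ N s := by
    have hs : s ∈ insert s N.support := Finset.mem_insert_self _ _
    have hsup := (support_add_single N s).subset
    rw [kCoeff_eq_prod_of_subset _ _ hsup, kCoeff_eq_prod_of_subset _ _ hsup,
      kCoeff_eq_prod_of_subset _ _ (support_subset_insert N s), ← Finset.mul_prod_erase _ _ hs,
      ← Finset.mul_prod_erase _ _ hs, ← Finset.mul_prod_erase _ _ hs, shifted_sub_single_self,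
      shifted_sub_column']
    set p := shifted A γ (N + Finsupp.single s 1) with hp
    have h1 : ∀ r ∈ (insert s N.support).erase s,
        binom (shifted A (γ - Pi.single s 1) (N + Finsupp.single s 1) r
          + ((N + Finsupp.single s 1 : S →₀ ℕ) r : ℚ)) ((N + Finsupp.single s 1 : S →₀ ℕ) r)
        = binom (p r + ((N + Finsupp.single s 1 : S →₀ ℕ) r : ℚ))
          ((N + Finsupp.single s 1 : S →₀ ℕ) r) := fun r hr => by
      rw [shifted_sub_single_of_ne _ _ (Finset.ne_of_mem_erase hr)]
    have h2 : ∀ r ∈ (insert s N.support).erase s,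
        binom (p r + (N r : ℚ)) (N r)
        = binom (p r + ((N + Finsupp.single s 1 : S →₀ ℕ) r : ℚ))
          ((N + Finsupp.single s 1 : S →₀ ℕ) r) := fun r hr => by
      simp [(Finset.ne_of_mem_erase hr).symm]
    rw [Finset.prod_congr rfl h1, Finset.prod_congr rfl h2, ← add_mul]
    congr 1
    have h3 : (N + Finsupp.single s 1 : S →₀ ℕ) s = N s + 1 := by simp
    rw [h3]
    push_cast
    have := binom_add_one (p s + N s) (N s)
    rw [show p s + ((N s : ℚ) + 1) = p s + N s + 1 by ring, this]
    ring_nf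

variable (A) in
/-- The `(s,r)` entry `δ_{sr} binom(x+n-1,n) + A_{sr} binom(x+n-1,n-1)` of the matrix whose
determinant gives the coefficients `rCoeff`. -/
noncomputable def rEntry [DecidableEq S] (x : ℚ) (n : ℕ) (s r : S) : ℚ :=
  (if s = r then binom (x + n - 1) n else 0) + A s r * (if n = 0 then 0 else binom (x + n - 1) (n - 1))

/-- The explicit zero at `n = 0` matters: with truncated subtraction the term in `A` would survive.
As it stands, indices outside the support of `N` give unit columns. -/
theorem rEntry_zero [DecidableEq S] (x : ℚ) (s r : S) :
    rEntry A x 0 s r = if s = r then 1 else 0 := by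
  simp [rEntry, binom_zero_right]

theorem rEntry_add_one [DecidableEq S] (x : ℚ) (n : ℕ) (s r : S) :
    rEntry A x (n + 1) s r = rEntry A (x - 1) (n + 1) s r + rEntry A x n s r := by
  have h1 : binom (x + n) (n + 1) = binom (x + n - 1) (n + 1) + binom (x + n - 1) n := by
    rw [← binom_add_one]; ring_nf
  have h2 : binom (x + n) n
      = binom (x + n - 1) n + if n = 0 then 0 else binom (x + n - 1) (n - 1) := by
    rcases n with _ | n
    · simp [binom_zero_right]
    · rw [if_neg (Nat.succ_ne_zero n), Nat.add_sub_cancel, ← binom_add_one]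
      congr 1
      ring
  have e1 : x + ((n + 1 : ℕ) : ℚ) - 1 = x + n := by push_cast; ring
  have e2 : x - 1 + ((n + 1 : ℕ) : ℚ) - 1 = x + n - 1 := by push_cast; ring
  simp only [rEntry, e1, e2, Nat.succ_ne_zero, if_false, Nat.add_sub_cancel]
  rw [h1, h2]
  split_ifs <;> ring

variable (A) in
/-- The determinant over a finite index set `T` of the matrix with entries `rEntry`. -/
noncomputable def rDet [DecidableEq S] (T : Finset S) (p : S → ℚ) (N : S →₀ ℕ) : ℚ :=
  (Matrix.of fun s r : T => rEntry A (p r) (N r) s r).det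

variable (A) in
/-- The coefficients `det(δ P + A N) ∏ binom(P+N-1,N-1)/N` with `P = γ - A N`. -/
noncomputable def rCoeff [DecidableEq S] (γ : S → ℤ) (N : S →₀ ℕ) : ℚ :=
  rDet A N.support (shifted A γ N) N

/-- Columns outside the support are unit vectors, so the matrix is block triangular with an identity
block. This lets the determinants for `N` and `N + e_s` be compared over one index set. -/
theorem rDet_eq_of_subset [DecidableEq S] (p : S → ℚ) (N : S →₀ ℕ) {T : Finset S}
    (h : N.support ⊆ T) : rDet A T p N = rDet A N.support p N := by
  have key : ∀ i j : T, (j : S) ∉ N.support → rEntry A (p j) (N j) i j = if i = j then 1 else 0 := by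
    intro i j hj
    rw [Finsupp.notMem_support_iff.mp hj, rEntry_zero]
    simp
  rw [rDet, Matrix.twoBlockTriangular_det' _ (fun i : T => (i : S) ∈ N.support)]
  · have h2 : (Matrix.toSquareBlockProp
        (Matrix.of fun s r : T => rEntry A (p r) (N r) (s : S) (r : S))
        fun i : T => ¬ ((i : S) ∈ N.support)) = 1 := by
      ext i j
      rw [Matrix.toSquareBlockProp_def, Matrix.of_apply, Matrix.of_apply, key _ _ j.2,
        Matrix.one_apply]
      simp [Subtype.val_inj]
    rw [h2, Matrix.det_one, mul_one, rDet]
    let e : {i : T // (i : S) ∈ N.support} ≃ N.support :=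
      { toFun := fun i => ⟨i.1.1, i.2⟩
        invFun := fun i => ⟨⟨i.1, h i.2⟩, i.2⟩
        left_inv := fun _ => rfl
        right_inv := fun _ => rfl }
    rw [← Matrix.det_submatrix_equiv_self e]
    rfl
  · intro i hi j hj
    rw [Matrix.of_apply, key _ _ hj, if_neg]
    rintro rfl
    exact hj hi

/-- Column `r` depends on `γ` and `N` only through `P_r` and `N_r`. Passing to `γ - e_s` lowers
`P_s` alone, and `(γ - A_s, N)` has the same `P` as `(γ, N + e_s)`. The three matrices thus differ
only in column `s`, where `rEntry_add_one` applies. -/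
theorem isPascal_rCoeff [DecidableEq S] : IsPascal A (rCoeff A) where
  congr {γ γ' N} h := by
    unfold rCoeff rDet
    congr 2
    ext s r
    rw [shifted_congr N (h r r.2)]
  add_single γ N s := by
    have hsup := (support_add_single N s).subset
    unfold rCoeff
    rw [← rDet_eq_of_subset _ _ hsup, ← rDet_eq_of_subset _ _ hsup,
      ← rDet_eq_of_subset _ _ (support_subset_insert N s), shifted_sub_column']
    set p := shifted A γ (N + Finsupp.single s 1) with hp
    set T := insert s N.support
    let j : T := ⟨s, Finset.mem_insert_self _ _⟩
    set M : Matrix T T ℚ := Matrix.of fun i r : T =>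
      rEntry A (p r) ((N + Finsupp.single s 1 : S →₀ ℕ) r) i r with hM
    have hN : (N + Finsupp.single s 1 : S →₀ ℕ) s = N s + 1 := by simp
    have h0 : M = M.updateCol j ((fun i : T => rEntry A (p s - 1) (N s + 1) i s)
        + fun i : T => rEntry A (p s) (N s) i s) := by
      ext i r
      rw [Matrix.updateCol_apply]
      split_ifs with hr
      · subst hr
        simp only [hM, Matrix.of_apply, j, hN, Pi.add_apply]
        exact rEntry_add_one _ _ _ _
      · rfl
    have h1 : Matrix.of (fun i r : T => rEntry A
          (shifted A (γ - Pi.single s 1) (N + Finsupp.single s 1) r)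
          ((N + Finsupp.single s 1 : S →₀ ℕ) r) (i : S) (r : S))
        = M.updateCol j (fun i : T => rEntry A (p s - 1) (N s + 1) i s) := by
      ext i r
      rw [Matrix.updateCol_apply]
      split_ifs with hr
      · subst hr
        simp only [Matrix.of_apply, j, hN, shifted_sub_single_self, hp]
      · have hr' : (r : S) ≠ s := fun h => hr (Subtype.ext h)
        simp only [Matrix.of_apply, shifted_sub_single_of_ne _ _ hr', hM, hp]
    have h2 : Matrix.of (fun i r : T => rEntry A (p r) (N r) (i : S) (r : S))
        = M.updateCol j (fun i : T => rEntry A (p s) (N s) i s) := by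
      ext i r
      rw [Matrix.updateCol_apply]
      split_ifs with hr
      · subst hr
        rfl
      · have hr' : (r : S) ≠ s := fun h => hr (Subtype.ext h)
        simp [hM, Finsupp.single_apply, hr'.symm]
    unfold rDet
    rw [h1, h2, ← Matrix.det_updateCol_add, ← h0]

theorem rCoeff_zero_right [DecidableEq S] (γ : S → ℤ) : rCoeff A γ 0 = 1 := by
  unfold rCoeff rDet
  have : IsEmpty ((0 : S →₀ ℕ).support : Finset S) := ⟨fun x => Finsupp.mem_support_iff.mp x.2 rfl⟩
  exact Matrix.det_isEmpty

/-- The product scales the columns of the determinant; `x * binom(x+n-1,n-1) / n = binom(x+n-1,n)`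
turns the diagonal term into the one in `rEntry`. -/
theorem rCoeff_eq_det_mul [DecidableEq S] (γ : S → ℤ) (N : S →₀ ℕ) :
    rCoeff A γ N = (Matrix.of fun s r : N.support =>
      (if s = r then shifted A γ N s else 0) + A s r * (N r : ℚ)).det *
      ∏ s ∈ N.support, (1 / (N s : ℚ)) * binom (shifted A γ N s + N s - 1) (N s - 1) := by
  rw [mul_comm, ← Finset.prod_coe_sort, ← Matrix.det_mul_row]
  unfold rCoeff rDet
  congr 2
  ext s r
  obtain ⟨n, hn⟩ := Nat.exists_eq_succ_of_ne_zero (Finsupp.mem_support_iff.mp r.2)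
  have hb := binom_succ_mul (shifted A γ N r + n) n
  have hn' : ((n : ℚ) + 1) ≠ 0 := by positivity
  have e : shifted A γ N r + ((n + 1 : ℕ) : ℚ) - 1 = shifted A γ N r + n := by push_cast; ring
  simp only [rEntry, hn, Nat.succ_eq_add_one, e, Nat.succ_ne_zero, if_false, Nat.add_sub_cancel,
    Matrix.of_apply]
  have hb' : binom (shifted A γ N r + n) (n + 1)
      = binom (shifted A γ N r + n) n * shifted A γ N r / (n + 1) := by
    rw [eq_div_iff hn', hb]; ring
  by_cases hsr : s = r
  · subst hsr
    simp only [if_true, hb']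
    push_cast
    field_simp
  · rw [if_neg hsr, if_neg fun h => hsr (Subtype.ext h)]
    push_cast
    field_simp
    ring

/-- The row sums of the matrix are `P_s + (A N)_s = γ_s = 0`, so the all-ones vector lies in its
kernel. -/
theorem rCoeff_zero_left [DecidableEq S] {N : S →₀ ℕ} (hN : N ≠ 0) : rCoeff A 0 N = 0 := by
  rw [rCoeff_eq_det_mul]
  refine mul_eq_zero_of_left ?_ _
  rw [← Matrix.exists_mulVec_eq_zero_iff]
  obtain ⟨s, hs⟩ := Finsupp.support_nonempty_iff.mpr hN
  refine ⟨1, fun h => one_ne_zero (congrFun h ⟨s, hs⟩), ?_⟩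
  ext i
  simp only [Matrix.mulVec, dotProduct, Matrix.of_apply, Pi.one_apply, mul_one,
    Finset.sum_add_distrib, Finset.sum_ite_eq, Finset.mem_univ, if_true, shifted, Finsupp.sum,
    Pi.zero_apply]
  rw [Finset.sum_coe_sort N.support fun r => (A i r : ℚ) * (N r : ℚ)]
  simp

theorem kCoeff_zero_right (γ : S → ℤ) : kCoeff A γ 0 = 1 := by simp [kCoeff]

end Pascal

end QSystem

namespace QSystem

/-! ### Power series modulo terms of high degree -/

section LowDegree

variable (I : Type*)

/-- The ideal of the power series without terms of total degree less than `n`. -/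
def degreeIdeal (n : ℕ) : Ideal (MvPowerSeries I ℂ) where
  carrier := {f | ∀ d : I →₀ ℕ, d.degree < n → MvPowerSeries.coeff d f = 0}
  add_mem' hf hg d hd := by rw [map_add, hf d hd, hg d hd, add_zero]
  zero_mem' _ _ := map_zero _
  smul_mem' c f hf d hd := by
    classical
    rw [smul_eq_mul, MvPowerSeries.coeff_mul]
    refine Finset.sum_eq_zero fun p hp => ?_
    have h : p.2.degree ≤ d.degree := by
      rw [← Finset.HasAntidiagonal.mem_antidiagonal.mp hp, map_add]
      exact Nat.le_add_left _ _
    rw [hf p.2 (h.trans_lt hd), mul_zero]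

variable {I}

theorem mem_degreeIdeal {n : ℕ} {f : MvPowerSeries I ℂ} :
    f ∈ degreeIdeal I n ↔ ∀ d : I →₀ ℕ, d.degree < n → MvPowerSeries.coeff d f = 0 :=
  Iff.rfl

theorem mem_degreeIdeal_zero (f : MvPowerSeries I ℂ) : f ∈ degreeIdeal I 0 :=
  fun _ h => absurd h (Nat.not_lt_zero _)

theorem eq_of_forall_sub_mem {f g : MvPowerSeries I ℂ} (h : ∀ n, f - g ∈ degreeIdeal I n) :
    f = g := by
  ext d
  have := h (d.degree + 1) d (Nat.lt_succ_self _)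
  rwa [map_sub, sub_eq_zero] at this

theorem coeff_X_pow_mul (a : I) (m : ℕ) (f : MvPowerSeries I ℂ) (d : I →₀ ℕ) :
    MvPowerSeries.coeff d (MvPowerSeries.X a ^ m * f)
      = if m ≤ d a then MvPowerSeries.coeff (d - Finsupp.single a m) f else 0 := by
  classical
  rw [MvPowerSeries.X_pow_eq, MvPowerSeries.coeff_monomial_mul, one_mul]
  simp only [Finsupp.single_le_iff]

theorem X_pow_mul_mem {n m : ℕ} (hm : 0 < m) (a : I) {f : MvPowerSeries I ℂ}
    (hf : f ∈ degreeIdeal I n) : MvPowerSeries.X a ^ m * f ∈ degreeIdeal I (n + 1) := by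
  intro d hd
  rw [coeff_X_pow_mul]
  split_ifs with h
  · refine hf _ ?_
    have h1 : d - Finsupp.single a m + Finsupp.single a m = d :=
      tsub_add_cancel_of_le (Finsupp.single_le_iff.mpr h)
    have h2 := congrArg Finsupp.degree h1
    rw [map_add, Finsupp.degree_single] at h2
    omega
  · rfl

end LowDegree

/-! ### Families of power series satisfying the Pascal recurrence -/

section Family

variable {I : Type*} (A : I × ℕ+ → I × ℕ+ → ℤ)

/-- A family of power series `F γ` satisfying `F γ = F (γ - e_s) + y_a ^ m F (γ - A_s)` for
`s = (a,m)`, where each coefficient depends on finitely many entries of `γ`. -/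
structure IsPascalSeries [DecidableEq I] (F : (I × ℕ+ → ℤ) → MvPowerSeries I ℂ) : Prop where
  recurrence : ∀ γ s, F γ = F (γ - Pi.single s 1)
    + MvPowerSeries.X s.1 ^ (s.2 : ℕ) * F (γ - fun r => A r s)
  finitary : ∀ n, ∃ T : Finset (I × ℕ+), ∀ γ γ', (∀ s ∈ T, γ s = γ' s) →
    F γ - F γ' ∈ degreeIdeal I n

namespace IsPascalSeries

variable {A} [DecidableEq I] {F G : (I × ℕ+ → ℤ) → MvPowerSeries I ℂ}

theorem sub (hF : IsPascalSeries A F) (hG : IsPascalSeries A G) :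
    IsPascalSeries A fun γ => F γ - G γ where
  recurrence γ s := by
    rw [hF.recurrence γ s, hG.recurrence γ s]
    ring
  finitary n := by
    obtain ⟨T, hT⟩ := hF.finitary n
    obtain ⟨T', hT'⟩ := hG.finitary n
    refine ⟨T ∪ T', fun γ γ' h => ?_⟩
    have h1 := hT γ γ' fun s hs => h s (Finset.mem_union_left _ hs)
    have h2 := hT' γ γ' fun s hs => h s (Finset.mem_union_right _ hs)
    rw [show F γ - G γ - (F γ' - G γ') = F γ - F γ' - (G γ - G γ') by ring]
    exact sub_mem h1 h2

theorem const_mul (hF : IsPascalSeries A F) (f : MvPowerSeries I ℂ) :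
    IsPascalSeries A fun γ => f * F γ where
  recurrence γ s := by
    rw [hF.recurrence γ s]
    ring
  finitary n := by
    obtain ⟨T, hT⟩ := hF.finitary n
    refine ⟨T, fun γ γ' h => ?_⟩
    rw [← mul_sub]
    exact Ideal.mul_mem_left _ _ (hT γ γ' h)

theorem translate (hF : IsPascalSeries A F) (δ : I × ℕ+ → ℤ) :
    IsPascalSeries A fun γ => F (δ + γ) where
  recurrence γ s := by
    rw [hF.recurrence (δ + γ) s, add_sub_assoc, add_sub_assoc]
  finitary n := by
    obtain ⟨T, hT⟩ := hF.finitary n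
    exact ⟨T, fun γ γ' h => hT _ _ fun s hs => by simp [h s hs]⟩

/-- If all values vanish below degree `n`, the recurrence shows that changing one entry of `γ` does
not affect `F γ` below degree `n + 1`. Finitely many such changes connect `γ` to `0`, up to entries
that `finitary` makes irrelevant. -/
theorem eq_zero (hF : IsPascalSeries A F) (h0 : F 0 = 0) (γ : I × ℕ+ → ℤ) : F γ = 0 := by
  suffices h : ∀ n γ, F γ ∈ degreeIdeal I n from
    eq_of_forall_sub_mem fun n => by simpa using h n γ
  intro n
  induction n with
  | zero => exact fun γ => mem_degreeIdeal_zero _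
  | succ n ih =>
    have step : ∀ γ s, F γ - F (γ - Pi.single s 1) ∈ degreeIdeal I (n + 1) := fun γ s => by
      rw [hF.recurrence γ s, add_sub_cancel_left]
      exact X_pow_mul_mem s.2.pos _ (ih _)
    have hstep : ∀ γ s (k : ℤ), F (γ + Pi.single s k) - F γ ∈ degreeIdeal I (n + 1) := by
      intro γ s k
      induction k using Int.induction_on with
      | zero => simp
      | succ k hk =>
        have h1 := step (γ + Pi.single s ((k : ℤ) + 1)) s
        rw [Pi.single_add, ← add_assoc, add_sub_cancel_right] at h1
        rw [Pi.single_add, ← add_assoc]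
        simpa using add_mem h1 hk
      | pred k hk =>
        have h1 := step (γ + Pi.single s (-(k : ℤ))) s
        rw [add_sub_assoc, ← Pi.single_sub] at h1
        simpa using sub_mem hk h1
    obtain ⟨T, hT⟩ := hF.finitary (n + 1)
    intro γ
    have hfin : ∀ U : Finset (I × ℕ+), F (∑ s ∈ U, Pi.single s (γ s)) ∈ degreeIdeal I (n + 1) := by
      intro U
      induction U using Finset.induction_on with
      | empty => simp [h0]
      | insert s U hs hU =>
        rw [Finset.sum_insert hs, add_comm (Pi.single (M := fun _ => ℤ) s (γ s))]
        simpa using add_mem (hstep (∑ s ∈ U, Pi.single s (γ s)) s (γ s)) hU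
    have h1 := hT γ (∑ s ∈ T, Pi.single s (γ s)) fun s hs => by
      rw [Finset.sum_apply, Finset.sum_eq_single s]
      · simp
      · intro r _ hr
        simp [hr.symm]
      · exact fun h => absurd hs h
    simpa using add_mem h1 (hfin T)

theorem eq_of_zero (hF : IsPascalSeries A F) (hG : IsPascalSeries A G) (h0 : F 0 = G 0)
    (γ : I × ℕ+ → ℤ) : F γ = G γ :=
  sub_eq_zero.mp ((hF.sub hG).eq_zero (sub_eq_zero.mpr h0) γ)

/-- As functions of `δ`, both sides solve the recurrence and agree at `δ = 0`. -/
theorem map_add (hF : IsPascalSeries A F) (h1 : F 0 = 1) (γ δ : I × ℕ+ → ℤ) :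
    F (γ + δ) = F γ * F δ :=
  (hF.translate γ).eq_of_zero (hF.const_mul (F γ)) (by simp [h1]) δ

/-- A Pascal family with `F 0 = 1` as a homomorphism to the units. -/
noncomputable def toUnits (hF : IsPascalSeries A F) (h1 : F 0 = 1) :
    Multiplicative (I × ℕ+ → ℤ) →* (MvPowerSeries I ℂ)ˣ :=
  MonoidHom.toHomUnits
    { toFun := fun γ => F γ.toAdd
      map_one' := h1
      map_mul' := fun γ δ => hF.map_add h1 γ.toAdd δ.toAdd }

@[simp]
theorem coe_toUnits (hF : IsPascalSeries A F) (h1 : F 0 = 1) (γ : Multiplicative (I × ℕ+ → ℤ)) :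
    (hF.toUnits h1 γ : MvPowerSeries I ℂ) = F γ.toAdd := rfl

end IsPascalSeries

end Family

/-! ### The specialized series of a Pascal family of coefficients -/

section Specialized

variable {I : Type*}

theorem weight_add_single (N : I × ℕ+ →₀ ℕ) (s : I × ℕ+) :
    weight (N + Finsupp.single s 1) = weight N + Finsupp.single s.1 (s.2 : ℕ) := by
  classical
  rw [weight, Finsupp.sum_add_index (by simp) (by intros; rw [mul_add, Finsupp.single_add]),
    Finsupp.sum_single_index (by simp), mul_one, weight]

theorem weight_eq_zero {N : I × ℕ+ →₀ ℕ} (h : weight N = 0) : N = 0 := by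
  ext s
  have h1 := le_weight N s
  rw [h] at h1
  have h2 := s.2.pos
  simp only [Finsupp.coe_zero, Pi.zero_apply] at h1 ⊢
  rcases Nat.mul_eq_zero.mp (Nat.le_zero.mp h1) with h | h
  · omega
  · exact h

variable [Finite I]

theorem coeff_specializedSeries (c : (I × ℕ+ →₀ ℕ) → ℚ) (d : I →₀ ℕ) :
    MvPowerSeries.coeff d (specializedSeries c)
      = ((∑ N ∈ (finite_weight_eq d).toFinset, c N : ℚ) : ℂ) := rfl

theorem constantCoeff_specializedSeries (c : (I × ℕ+ →₀ ℕ) → ℚ) :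
    MvPowerSeries.constantCoeff (specializedSeries c) = (c 0 : ℂ) := by
  rw [← MvPowerSeries.coeff_zero_eq_constantCoeff_apply, coeff_specializedSeries]
  have h : (finite_weight_eq (0 : I →₀ ℕ)).toFinset = {0} := by
    ext N
    rw [Set.Finite.mem_toFinset, Finset.mem_singleton, Set.mem_ofPred_eq]
    exact ⟨weight_eq_zero, by rintro rfl; simp [weight]⟩
  rw [h, Finset.sum_singleton]

theorem specializedSeries_eq_one {c : (I × ℕ+ →₀ ℕ) → ℚ} (h0 : c 0 = 1)
    (h : ∀ N, N ≠ 0 → c N = 0) : specializedSeries c = 1 := by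
  classical
  ext d
  rw [coeff_specializedSeries, MvPowerSeries.coeff_one]
  split_ifs with hd
  · subst hd
    rw [← coeff_specializedSeries, MvPowerSeries.coeff_zero_eq_constantCoeff_apply,
      constantCoeff_specializedSeries, h0, Rat.cast_one]
  · rw [Finset.sum_eq_zero, Rat.cast_zero]
    intro N hN
    refine h N ?_
    rintro rfl
    refine hd ?_
    rw [Set.Finite.mem_toFinset, Set.mem_ofPred_eq] at hN
    rw [← hN]
    simp [weight]

variable [DecidableEq I] {A : I × ℕ+ → I × ℕ+ → ℤ} {c : (I × ℕ+ → ℤ) → (I × ℕ+ →₀ ℕ) → ℚ}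

theorem IsPascal.isPascalSeries (hc : IsPascal A c) :
    IsPascalSeries A fun γ => specializedSeries (c γ) where
  recurrence γ s := by
    ext d
    rw [map_add, coeff_X_pow_mul]
    simp only [coeff_specializedSeries]
    set W := (finite_weight_eq d).toFinset with hW
    have hsplit : ∀ γ, ∑ N ∈ W, c γ N = ∑ N ∈ W with N s = 0, c γ N
        + ∑ N ∈ W with ¬ N s = 0, c γ N := fun γ =>
      (Finset.sum_filter_add_sum_filter_not W (fun N => N s = 0) _).symm
    -- When `N s = 0` the coefficient does not see `γ s`, so the shift by `e_s` is free.
    have h0 : ∑ N ∈ W with N s = 0, c γ N = ∑ N ∈ W with N s = 0, c (γ - Pi.single s 1) N := by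
      refine Finset.sum_congr rfl fun N hN => hc.congr fun r hr => ?_
      have hrs : r ≠ s := by
        rintro rfl
        exact Finsupp.mem_support_iff.mp hr (Finset.mem_filter.mp hN).2
      simp [hrs]
    have hsub : ∀ N : I × ℕ+ →₀ ℕ, N s ≠ 0 → N - Finsupp.single s 1 + Finsupp.single s 1 = N :=
      fun N hN => tsub_add_cancel_of_le (Finsupp.single_le_iff.mpr (Nat.one_le_iff_ne_zero.mpr hN))
    have h1 : ∑ N ∈ W with ¬ N s = 0, c γ N
        = ∑ N ∈ W with ¬ N s = 0, c (γ - Pi.single s 1) N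
          + ∑ N ∈ W with ¬ N s = 0, c (γ - fun r => A r s) (N - Finsupp.single s 1) := by
      rw [← Finset.sum_add_distrib]
      refine Finset.sum_congr rfl fun N hN => ?_
      have := hc.add_single γ (N - Finsupp.single s 1) s
      rwa [hsub N (Finset.mem_filter.mp hN).2] at this
    -- Removing one unit at `s = (a,m)` lowers the weight by `m` in the variable `a`; the sum is
    -- empty when `m` exceeds the exponent `d a`.
    have h2 : ∀ f : (I × ℕ+ →₀ ℕ) → ℚ,
        ((∑ N ∈ W with ¬ N s = 0, f (N - Finsupp.single s 1) : ℚ) : ℂ)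
        = if (s.2 : ℕ) ≤ d s.1 then
          ((∑ N ∈ (finite_weight_eq (d - Finsupp.single s.1 (s.2 : ℕ))).toFinset, f N : ℚ) : ℂ)
          else 0 := by
      intro f
      split_ifs with hd
      · congr 1
        have hd' := tsub_add_cancel_of_le (Finsupp.single_le_iff.mpr hd)
        refine Finset.sum_nbij' (fun N => N - Finsupp.single s 1) (fun N => N + Finsupp.single s 1)
          ?_ ?_ ?_ ?_ ?_
        · intro N hN
          obtain ⟨hN, hNs⟩ := Finset.mem_filter.mp hN
          rw [hW, Set.Finite.mem_toFinset, Set.mem_ofPred_eq] at hN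
          rw [Set.Finite.mem_toFinset, Set.mem_ofPred_eq, ← hN]
          conv_rhs => rw [← hsub N hNs, weight_add_single]
          rw [add_tsub_cancel_right]
        · intro N hN
          rw [Set.Finite.mem_toFinset, Set.mem_ofPred_eq] at hN
          rw [Finset.mem_filter, hW, Set.Finite.mem_toFinset, Set.mem_ofPred_eq,
            weight_add_single, hN]
          exact ⟨hd', by simp⟩
        · exact fun N hN => hsub N (Finset.mem_filter.mp hN).2
        · exact fun N _ => add_tsub_cancel_right N _
        · exact fun N _ => rfl
      · rw [Finset.sum_eq_zero, Rat.cast_zero]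
        intro N hN
        obtain ⟨hN, hNs⟩ := Finset.mem_filter.mp hN
        rw [hW, Set.Finite.mem_toFinset, Set.mem_ofPred_eq] at hN
        have := le_weight N s
        rw [hN] at this
        exact absurd ((Nat.le_mul_of_pos_right _ (Nat.pos_of_ne_zero hNs)).trans this) hd
    rw [hsplit γ, hsplit (γ - Pi.single s 1), h0, h1, ← h2]
    push_cast
    ring
  finitary n := by
    have hfin : {d : I →₀ ℕ | d.degree ≤ n}.Finite := Finsupp.finite_of_degree_le n
    refine ⟨hfin.toFinset.biUnion fun d => (finite_weight_eq d).toFinset.biUnion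
      fun N => N.support, fun γ γ' h d hd => ?_⟩
    rw [map_sub, coeff_specializedSeries, coeff_specializedSeries, sub_eq_zero]
    congr 1
    refine Finset.sum_congr rfl fun N hN => hc.congr fun s hs => h s ?_
    simp only [Finset.mem_biUnion]
    exact ⟨d, hfin.mem_toFinset.mpr hd.le, N, hN, hs⟩

end Specialized

end QSystem

namespace QSystem

/-! ### Uniqueness of the convergent solution of the `Q`-system -/

section Uniqueness

variable {I : Type*}

/-- Reduction of units modulo the power series without terms of degree less than `n`. -/
noncomputable def unitsMod (n : ℕ) :
    (MvPowerSeries I ℂ)ˣ →* (MvPowerSeries I ℂ ⧸ degreeIdeal I n)ˣ :=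
  Units.map (Ideal.Quotient.mk (degreeIdeal I n) : MvPowerSeries I ℂ →* _)

theorem unitsMod_eq_iff {n : ℕ} {u v : (MvPowerSeries I ℂ)ˣ} :
    unitsMod n u = unitsMod n v ↔ (u : MvPowerSeries I ℂ) - v ∈ degreeIdeal I n := by
  rw [← Ideal.Quotient.mk_eq_mk_iff_sub_mem, Units.ext_iff]
  rfl

theorem eq_pow_of_sq_eq {G : Type*} [CommGroup G] (u : ℕ → G) (h0 : u 0 = 1)
    (h : ∀ m, 1 ≤ m → u m ^ 2 = u (m + 1) * u (m - 1)) (m : ℕ) :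
    u m = u 1 ^ m ∧ u (m + 1) = u 1 ^ (m + 1) := by
  induction m with
  | zero => simp [h0]
  | succ m ih =>
    refine ⟨ih.2, ?_⟩
    have h1 := h (m + 1) (Nat.le_add_left _ _)
    rw [Nat.add_sub_cancel, ih.1, ih.2, ← pow_mul] at h1
    rw [← mul_left_inj (u 1 ^ m), ← h1, ← pow_add]
    congr 1
    ring

theorem div_sq_eq_of_ratio_eq {G : Type*} [CommGroup G] {x y p p' q q' : G}
    (h : p * q * (x ^ 2)⁻¹ = p' * q' * (y ^ 2)⁻¹) : (x / y) ^ 2 = p / p' * (q / q') := by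
  rw [mul_inv_eq_iff_eq_mul] at h
  rw [div_pow, div_mul_div_comm, h, div_eq_div_iff_mul_eq_mul, mul_right_comm,
    inv_mul_cancel_right, mul_comm]

theorem Converges.exists_unitsMod_eq [Finite I] {Q : I × ℕ+ → (MvPowerSeries I ℂ)ˣ}
    (hQ : Converges Q) (n : ℕ) (a : I) :
    ∃ M : ℕ+, ∀ m, M ≤ m → unitsMod n (Q (a, m)) = unitsMod n (Q (a, M)) := by
  obtain ⟨f, hf⟩ := hQ a
  have hfin : {d : I →₀ ℕ | d.degree ≤ n}.Finite := Finsupp.finite_of_degree_le n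
  obtain ⟨M, hM⟩ := Filter.eventually_atTop.mp (hfin.eventually_all.mpr fun d _ => hf d)
  refine ⟨M, fun m hm => unitsMod_eq_iff.mpr fun d hd => ?_⟩
  rw [map_sub, hM m hm d hd.le, hM M le_rfl d hd.le, sub_self]

@[simp]
theorem extend_zero {G : Type*} [One G] (Q : I × ℕ+ → G) (a : I) : extend Q a 0 = 1 := by
  simp [extend]

@[simp]
theorem extend_coe {G : Type*} [One G] (Q : I × ℕ+ → G) (a : I) (m : ℕ+) :
    extend Q a m = Q (a, m) := by
  simp only [extend, m.pos, dif_pos]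
  rfl

theorem extend_add_one {G : Type*} [One G] (Q : I × ℕ+ → G) (a : I) (m : ℕ+) :
    extend Q a ((m : ℕ) + 1) = Q (a, m + 1) := by
  rw [← extend_coe Q a (m + 1), PNat.add_coe, PNat.one_coe]

variable [Finite I] {g : I → I → ℚ}

/-- Dividing the equation by the square of `Q (a, m)` gives a ratio `1 - y_a ^ m * ∏`. Agreement of
the products below degree `n` therefore becomes agreement of the ratios below degree `n + 1`. -/
theorem eq_of_isSolution_of_converges (hg : ∀ a, 0 < g a a)
    {Q Q' : I × ℕ+ → (MvPowerSeries I ℂ)ˣ} (hQ : IsSolution g Q) (hc : Converges Q)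
    (hQ' : IsSolution g Q') (hc' : Converges Q') : Q = Q' := by
  obtain ⟨e, he, hQ⟩ := hQ
  obtain ⟨e', he', hQ'⟩ := hQ'
  obtain rfl : e = e' := by
    ext s r
    exact_mod_cast (he s r).trans (he' s r).symm
  suffices h : ∀ n s, unitsMod n (Q s) = unitsMod n (Q' s) from
    funext fun s => Units.ext (eq_of_forall_sub_mem fun n => unitsMod_eq_iff.mp (h n s))
  intro n
  induction n with
  | zero => exact fun s => unitsMod_eq_iff.mpr (mem_degreeIdeal_zero _)
  | succ n ih =>
    have hprod : ∀ s, unitsMod n (∏ᶠ r, Q r ^ e s r) = unitsMod n (∏ᶠ r, Q' r ^ e s r) := by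
      intro s
      have hsub : ∀ P : I × ℕ+ → (MvPowerSeries I ℂ)ˣ,
          Function.mulSupport (fun r => P r ^ e s r) ⊆ (finite_B_ne_zero g hg s).toFinset := by
        intro P r hr
        rw [Set.Finite.coe_toFinset, Set.mem_ofPred_eq]
        intro h0
        have h1 := he s r
        rw [h0, mul_zero, neg_zero, Int.cast_eq_zero] at h1
        exact hr (by simp [h1])
      rw [finprod_eq_prod_of_mulSupport_subset _ (hsub Q),
        finprod_eq_prod_of_mulSupport_subset _ (hsub Q'), map_prod, map_prod]
      exact Finset.prod_congr rfl fun r _ => by rw [map_zpow, map_zpow, ih]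
    have hratio : ∀ (P : I × ℕ+ → (MvPowerSeries I ℂ)ˣ) (a : I) (m : ℕ+),
        (P (a, m) : MvPowerSeries I ℂ) ^ 2 =
          (P (a, m + 1) : MvPowerSeries I ℂ)
            * ((extend P a ((m : ℕ) - 1) : (MvPowerSeries I ℂ)ˣ) : MvPowerSeries I ℂ)
          + MvPowerSeries.X a ^ (m : ℕ) * (P (a, m) : MvPowerSeries I ℂ) ^ 2
            * ((∏ᶠ r : I × ℕ+, P r ^ e (a, m) r : (MvPowerSeries I ℂ)ˣ) : MvPowerSeries I ℂ) →
        ((P (a, m + 1) * extend P a ((m : ℕ) - 1) * (P (a, m) ^ 2)⁻¹ : (MvPowerSeries I ℂ)ˣ) :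
          MvPowerSeries I ℂ) = 1 - MvPowerSeries.X a ^ (m : ℕ)
            * ((∏ᶠ r : I × ℕ+, P r ^ e (a, m) r : (MvPowerSeries I ℂ)ˣ) : MvPowerSeries I ℂ) := by
      intro P a m h
      rw [Units.val_mul, Units.mul_inv_eq_iff_eq_mul, Units.val_mul, Units.val_pow_eq_pow_val,
        sub_mul, one_mul]
      nth_rewrite 1 [h]
      ring
    have hz : ∀ (a : I) (m : ℕ+),
        unitsMod (n + 1) (Q (a, m + 1) * extend Q a ((m : ℕ) - 1) * (Q (a, m) ^ 2)⁻¹)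
        = unitsMod (n + 1) (Q' (a, m + 1) * extend Q' a ((m : ℕ) - 1) * (Q' (a, m) ^ 2)⁻¹) := by
      intro a m
      rw [unitsMod_eq_iff, hratio Q a m (hQ a m), hratio Q' a m (hQ' a m), sub_sub_sub_cancel_left,
        ← mul_sub]
      exact X_pow_mul_mem m.pos _ (unitsMod_eq_iff.mp (hprod (a, m)).symm)
    rintro ⟨a, m⟩
    let u : ℕ → (MvPowerSeries I ℂ ⧸ degreeIdeal I (n + 1))ˣ := fun k =>
      unitsMod (n + 1) (extend Q a k / extend Q' a k)
    have hu0 : u 0 = 1 := by simp [u]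
    have hu : ∀ k, 1 ≤ k → u k ^ 2 = u (k + 1) * u (k - 1) := by
      intro k hk
      lift k to ℕ+ using hk
      have h1 := hz a k
      simp only [u, extend_coe, extend_add_one]
      simp only [map_mul, map_inv, map_pow, map_div] at h1 ⊢
      exact div_sq_eq_of_ratio_eq h1
    obtain ⟨M, hM⟩ := hc.exists_unitsMod_eq (n + 1) a
    obtain ⟨M', hM'⟩ := hc'.exists_unitsMod_eq (n + 1) a
    have hval : ∀ k : ℕ+, M ≤ k → M' ≤ k →
        u k = unitsMod (n + 1) (Q (a, M)) / unitsMod (n + 1) (Q' (a, M')) := by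
      intro k h1 h2
      simp only [u, extend_coe, map_div, hM k h1, hM' k h2]
    have hpow := fun k => (eq_pow_of_sq_eq u hu0 hu k).1
    -- Both sequences stabilize modulo degree `n + 1`, so two consecutive powers of `u 1` coincide.
    have hu1 : u 1 = 1 := by
      have h1 := hval (max M M') (le_max_left _ _) (le_max_right _ _)
      have h2 := hval (max M M' + 1) ((le_max_left _ _).trans (PNat.lt_add_right _ _).le)
        ((le_max_right _ _).trans (PNat.lt_add_right _ _).le)
      rw [← h1, PNat.add_coe, PNat.one_coe, hpow, hpow (max M M' : ℕ+), pow_succ] at h2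
      exact mul_eq_left.mp h2
    have h := hpow m
    rw [hu1, one_pow] at h
    simp only [u, extend_coe, map_div] at h
    exact div_eq_one.mp h

end Uniqueness

end QSystem

namespace QSystem

/-! ### The solution given by the series `R̃` -/

section Existence

variable {I : Type*} {g : I → I → ℚ}

/-- Whichever argument attains the minimum, `g a b` meets `t g a` or `t g b`, and that product is an
integer. Integer `x`, `y` allow the argument `k - 1` without truncation. -/
theorem exists_int_mul_min (hint : ∀ a b, ∃ k : ℤ, (k : ℚ) = t g a * g a b)
    (hsymm : ∀ a b, g a b = g b a) (a b : I) (x y : ℤ) :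
    ∃ k : ℤ, (k : ℚ) = g a b * min (t g b * x) (t g a * y) := by
  rcases min_choice (t g b * x) (t g a * y) with h | h
  · obtain ⟨k, hk⟩ := hint b a
    exact ⟨k * x, by rw [h, hsymm]; push_cast; rw [hk]; ring⟩
  · obtain ⟨k, hk⟩ := hint a b
    exact ⟨k * y, by rw [h]; push_cast; rw [hk]; ring⟩

/-- The vector `r ↦ δ_{ab} min(m,k)`, `r = (b,k)`. -/
def minVec [DecidableEq I] (a : I) (m : ℕ) (r : I × ℕ+) : ℤ :=
  if r.1 = a then min (m : ℤ) (r.2 : ℕ) else 0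

theorem minVec_zero [DecidableEq I] (a : I) : minVec a 0 = 0 := by
  ext r
  simp [minVec]

theorem gamma_single [DecidableEq I] (s r : I × ℕ+) :
    gamma (Finsupp.single s 1) r = minVec s.1 s.2 r := by
  rw [gamma, Finsupp.sum_single_index (by simp), minVec]
  by_cases h : r.1 = s.1
  · rw [if_pos h, if_pos h.symm, min_comm, Nat.cast_one, mul_one]
    rcases le_total s.2 r.2 with h1 | h1
    · rw [min_eq_left h1, min_eq_left (by exact_mod_cast h1), Int.cast_natCast]
    · rw [min_eq_right h1, min_eq_right (by exact_mod_cast h1), Int.cast_natCast]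
  · rw [if_neg h, if_neg (Ne.symm h), Int.cast_zero]

theorem gamma_zero (r : I × ℕ+) : gamma 0 r = 0 := by simp [gamma]

theorem minVec_second_difference [DecidableEq I] (a : I) (m : ℕ+) :
    minVec a m + minVec a m - Pi.single (a, m) 1 = minVec a (m + 1) + minVec a (m - 1) := by
  ext ⟨b, k⟩
  simp only [Pi.sub_apply, Pi.add_apply, minVec, Pi.single_apply, Prod.mk.injEq]
  have hm := m.pos
  by_cases hb : b = a
  · by_cases hk : k = m
    · subst hk
      simp only [hb, and_self, if_true]
      omega
    · have hk' : (k : ℕ) ≠ m := fun h => hk (PNat.coe_injective h)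
      simp only [hb, hk, and_false, if_true, if_false]
      omega
  · simp [hb]

/-- Summation by parts: `min l k` is a discrete Green function, linear up to `l` and constant after
it. The last term is the boundary contribution, which vanishes once `f` is constant. -/
theorem sum_second_difference_mul_min (f : ℕ → ℚ) (h0 : f 0 = 0) {l M : ℕ} (hM : l ≤ M) :
    ∑ k ∈ Finset.range M, (2 * f (k + 1) - f (k + 2) - f k) * min (l : ℚ) ((k : ℚ) + 1)
      = f l - l * (f (M + 1) - f M) := by
  have key : ∀ n ≤ l, ∑ k ∈ Finset.range n,
      (2 * f (k + 1) - f (k + 2) - f k) * min (l : ℚ) ((k : ℚ) + 1)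
      = f n - n * (f (n + 1) - f n) := by
    intro n hn
    induction n with
    | zero => simp [h0]
    | succ n ih =>
      rw [Finset.sum_range_succ, ih (by omega), min_eq_right (by exact_mod_cast hn)]
      push_cast
      ring
  induction M, hM using Nat.le_induction with
  | base => exact key l le_rfl
  | succ M hM ih =>
    rw [Finset.sum_range_succ, ih, min_eq_left (by exact_mod_cast hM.trans (Nat.le_succ M))]
    ring

/-- In `k`, `B` is minus the second difference of `min (t_b m) (t_a k)`, so pairing it with `min k
l` recovers that function at `l`. This writes a column of `A` in terms of the vectors `minVec`. -/
theorem sum_B_mul_minVec [DecidableEq I] (hg : ∀ a, 0 < g a a) (s q : I × ℕ+)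
    {T : Finset (I × ℕ+)} (hT : ∀ r, B g s r ≠ 0 → r ∈ T) :
    ∑ r ∈ T, g s.1 r.1 * B g s r * minVec r.1 r.2 q
      = g s.1 q.1 * min (t g q.1 * s.2) (t g s.1 * q.2) := by
  obtain ⟨a, m⟩ := s
  obtain ⟨b, l⟩ := q
  have ht : ∀ a, 0 < t g a := fun a => div_pos two_pos (hg a)
  obtain ⟨n, hn⟩ := exists_nat_gt (t g b * m / t g a)
  rw [div_lt_iff₀ (ht a)] at hn
  -- From `n` on, `min (t_b m) (t_a k)` is constant in `k`, which kills the boundary term; `l ≤ M`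
  -- is needed for the summation formula.
  set M := max n l with hMdef
  have hM : ∀ x : ℚ, (M : ℚ) ≤ x → t g b * m ≤ t g a * x := by
    intro x hx
    have h1 : (n : ℚ) ≤ x := le_trans (by exact_mod_cast le_max_left n (l : ℕ)) hx
    nlinarith [ht a]
  set T' : Finset (I × ℕ+) := (Finset.range M).map
    ⟨fun k => (b, k.succPNat), fun k k' h => by simpa using h⟩
  set F : I × ℕ+ → ℚ := fun r => g a r.1 * B g (a, m) r * minVec r.1 r.2 (b, l) with hF
  have hsT : Function.support F ⊆ T := fun r hr => hT r fun h0 => hr (by simp [hF, h0])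
  have hsT' : Function.support F ⊆ T' := by
    rintro ⟨c, k⟩ hr
    have hc : b = c := by
      by_contra hbc
      exact hr (by simp [hF, minVec, hbc])
    subst hc
    rw [Finset.mem_coe, Finset.mem_map]
    refine ⟨k.natPred, Finset.mem_range.mpr ?_, ?_⟩
    · by_contra hk
      have hk' : M + 1 ≤ (k : ℕ) := by
        have := PNat.natPred_add_one k
        omega
      have hk2 : (M : ℚ) + 1 ≤ ((k : ℕ) : ℚ) := by exact_mod_cast hk'
      refine hr ?_
      have hB : B g (a, m) (b, k) = 0 := by
        simp only [B]
        rw [min_eq_left (hM _ (by linarith)), min_eq_left (hM _ (by linarith)),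
          min_eq_left (hM _ (by linarith))]
        ring
      simp [hF, hB]
    · exact Prod.ext rfl (PNat.succPNat_natPred k)
  change ∑ r ∈ T, F r = _
  rw [← finsum_eq_sum_of_support_subset F hsT, finsum_eq_sum_of_support_subset F hsT',
    Finset.sum_map]
  set f : ℕ → ℚ := fun k => min (t g b * m) (t g a * k) with hf
  have h0 : f 0 = 0 := by
    have : 0 ≤ t g b * (m : ℕ) := mul_nonneg (ht b).le (Nat.cast_nonneg _)
    simp [hf, this]
  have h1 := sum_second_difference_mul_min f h0 (le_max_right n (l : ℕ))
  have hfM : f (M + 1) = f M := by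
    simp only [hf]
    rw [min_eq_left (hM _ (by push_cast; linarith)), min_eq_left (hM _ le_rfl)]
  rw [← hMdef, hfM, sub_self, mul_zero, sub_zero] at h1
  change _ = g a b * f l
  rw [← h1, Finset.mul_sum]
  refine Finset.sum_congr rfl fun k _ => ?_
  have hmin : ((minVec b (k.succPNat : ℕ) (b, l) : ℤ) : ℚ) = min ((l : ℕ) : ℚ) ((k : ℚ) + 1) := by
    simp only [minVec, if_true, Nat.succPNat_coe]
    push_cast
    rw [min_comm]
  have hB : B g (a, m) (b, k.succPNat) = 2 * f (k + 1) - f (k + 2) - f k := by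
    simp only [B, hf, Nat.succPNat_coe]
    push_cast
    ring_nf
  change g a b * B g (a, m) (b, k.succPNat) * (minVec b (k.succPNat : ℕ) (b, l) : ℤ) = _
  rw [hmin, hB]
  ring

variable {A : I × ℕ+ → I × ℕ+ → ℤ}

theorem vacancy_eq_shifted
    (hA : ∀ s r, (A s r : ℚ) = g s.1 r.1 * min (t g r.1 * s.2) (t g s.1 * r.2))
    {ν : I × ℕ+ →₀ ℕ} {γ : I × ℕ+ → ℤ} (h : ∀ r, gamma ν r = γ r) (N : I × ℕ+ →₀ ℕ)
    (s : I × ℕ+) : vacancy g ν N s = shifted A γ N s := by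
  simp only [vacancy, shifted, h, hA]

theorem K_eq_kCoeff
    (hA : ∀ s r, (A s r : ℚ) = g s.1 r.1 * min (t g r.1 * s.2) (t g s.1 * r.2))
    {ν : I × ℕ+ →₀ ℕ} {γ : I × ℕ+ → ℤ} (h : ∀ r, gamma ν r = γ r) : K g ν = kCoeff A γ := by
  ext N
  simp only [K, kCoeff, vacancy_eq_shifted hA h]

theorem R_eq_rCoeff [DecidableEq I]
    (hA : ∀ s r, (A s r : ℚ) = g s.1 r.1 * min (t g r.1 * s.2) (t g s.1 * r.2))
    {ν : I × ℕ+ →₀ ℕ} {γ : I × ℕ+ → ℤ} (h : ∀ r, gamma ν r = γ r) : R g ν = rCoeff A γ := by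
  ext N
  rw [rCoeff_eq_det_mul]
  simp only [R, Fmat, vacancy_eq_shifted hA h, hA]
  congr 2
  · ext s r
    simp

variable [Finite I]

theorem exists_solution [DecidableEq I] (hg : ∀ a, 0 < g a a) (hsymm : ∀ a b, g a b = g b a)
    (hint : ∀ a b, ∃ k : ℤ, (k : ℚ) = t g a * g a b)
    (hA : ∀ s r, (A s r : ℚ) = g s.1 r.1 * min (t g r.1 * s.2) (t g s.1 * r.2))
    {F : (I × ℕ+ → ℤ) → MvPowerSeries I ℂ} (hF : IsPascalSeries A F) (h1 : F 0 = 1) :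
    ∃ Q : I × ℕ+ → (MvPowerSeries I ℂ)ˣ, IsSolution g Q ∧ Converges Q ∧
      ∀ s, (Q s : MvPowerSeries I ℂ) = F (minVec s.1 s.2) := by
  set ρ := hF.toUnits h1
  let Q : I × ℕ+ → (MvPowerSeries I ℂ)ˣ := fun s => ρ (.ofAdd (minVec s.1 s.2))
  have hext : ∀ a m, extend Q a m = ρ (.ofAdd (minVec a m)) := by
    intro a m
    rcases Nat.eq_zero_or_pos m with rfl | hm
    · simp [minVec_zero]
    · exact extend_coe Q a ⟨m, hm⟩
  refine ⟨Q, ?_, ?_, fun s => rfl⟩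
  · have hexp : ∀ s r : I × ℕ+, ∃ k : ℤ, (k : ℚ) = -(g s.1 r.1 * B g s r) := by
      intro s r
      obtain ⟨k₀, h₀⟩ := exists_int_mul_min hint hsymm s.1 r.1 (s.2 : ℕ) (r.2 : ℕ)
      obtain ⟨k₁, h₁⟩ := exists_int_mul_min hint hsymm s.1 r.1 (s.2 : ℕ) ((r.2 : ℕ) + 1)
      obtain ⟨k₂, h₂⟩ := exists_int_mul_min hint hsymm s.1 r.1 (s.2 : ℕ) ((r.2 : ℕ) - 1)
      refine ⟨-(2 * k₀ - k₁ - k₂), ?_⟩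
      push_cast at h₀ h₁ h₂ ⊢
      rw [h₀, h₁, h₂, B]
      ring
    choose e he using hexp
    refine ⟨e, he, fun a m => ?_⟩
    have hprod : ∏ᶠ r, Q r ^ e (a, m) r = ρ (.ofAdd (-fun r => A r (a, m))) := by
      have hsub : Function.mulSupport (fun r => Q r ^ e (a, m) r)
          ⊆ (finite_B_ne_zero g hg (a, m)).toFinset := by
        intro r hr
        rw [Set.Finite.coe_toFinset, Set.mem_ofPred_eq]
        intro h0
        have h1 := he (a, m) r
        rw [h0, mul_zero, neg_zero, Int.cast_eq_zero] at h1
        exact hr (by simp [h1])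
      rw [finprod_eq_prod_of_mulSupport_subset _ hsub]
      simp only [Q, ← map_zpow, ← map_prod, ← ofAdd_zsmul, ← ofAdd_sum]
      congr 2
      ext q
      have h2 := sum_B_mul_minVec hg (a, m) q (T := (finite_B_ne_zero g hg (a, m)).toFinset)
        fun r hr => by simpa using hr
      have h3 : (A q (a, m) : ℚ) = g a q.1 * min (t g q.1 * m) (t g a * q.2) := by
        rw [hA, hsymm, min_comm]
      have h4 : (((∑ r ∈ (finite_B_ne_zero g hg (a, m)).toFinset,
          e (a, m) r * minVec r.1 r.2 q : ℤ)) : ℚ) = ((-A q (a, m) : ℤ) : ℚ) := by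
        push_cast
        rw [h3, ← h2, ← Finset.sum_neg_distrib]
        exact Finset.sum_congr rfl fun r _ => by rw [he]; ring
      simpa [Finset.sum_apply] using Int.cast_injective h4
    -- Multiplicativity splits each of the three terms; `F (-A_s)` is the product computed in
    -- `hprod`.
    have hrec := hF.recurrence (minVec a m + minVec a m) (a, m)
    rw [minVec_second_difference, hF.map_add h1, hF.map_add h1, sub_eq_add_neg,
      hF.map_add h1, hF.map_add h1] at hrec
    rw [hprod, hext]
    simp only [Q, ρ, IsPascalSeries.coe_toUnits, toAdd_ofAdd, PNat.add_coe, PNat.one_coe]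
    rw [sq]
    exact hrec.trans (by ring)
  · intro a
    -- The entrywise limit of `minVec a m` as `m → ∞`, since `min m k` is eventually `k`.
    refine ⟨F fun r => if r.1 = a then (r.2 : ℕ) else 0, fun d => ?_⟩
    obtain ⟨T, hT⟩ := hF.finitary (d.degree + 1)
    filter_upwards [Filter.eventually_ge_atTop (T.sup fun r => (r.2 : ℕ)).succPNat] with m hm
    rw [← sub_eq_zero, ← map_sub]
    refine hT _ _ (fun r hr => ?_) d (Nat.lt_succ_self _)
    have h2 : (r.2 : ℕ) ≤ m := by
      have h3 := Finset.le_sup (f := fun r : I × ℕ+ => (r.2 : ℕ)) hr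
      have h4 : ((T.sup fun r => (r.2 : ℕ)).succPNat : ℕ) ≤ m := hm
      rw [Nat.succPNat_coe] at h4
      exact h3.trans ((Nat.le_succ _).trans h4)
    simp only [toAdd_ofAdd, minVec]
    rw [min_eq_right (by exact_mod_cast h2)]

theorem existsUnique_solution (hg : ∀ a, 0 < g a a) (hsymm : ∀ a b, g a b = g b a)
    (hint : ∀ a b, ∃ k : ℤ, (k : ℚ) = t g a * g a b) :
    (∃! Q : I × ℕ+ → (MvPowerSeries I ℂ)ˣ, IsSolution g Q ∧ Converges Q) ∧
    IsUnit (Ktilde g 0) ∧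
    ∀ Q : I × ℕ+ → (MvPowerSeries I ℂ)ˣ, IsSolution g Q → Converges Q → ∀ s : I × ℕ+,
      (Q s : MvPowerSeries I ℂ) = Rtilde g (Finsupp.single s 1) ∧
      (Q s : MvPowerSeries I ℂ) = Ktilde g (Finsupp.single s 1) * (Ktilde g 0)⁻¹ := by
  classical
  choose A hA using fun s r : I × ℕ+ =>
    exists_int_mul_min hint hsymm s.1 r.1 (s.2 : ℕ) (r.2 : ℕ)
  simp only [Int.cast_natCast] at hA
  have hR := (isPascal_rCoeff (A := A)).isPascalSeries
  have hK := (isPascal_kCoeff (A := A)).isPascalSeries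
  have hR0 : specializedSeries (rCoeff A 0) = 1 :=
    specializedSeries_eq_one (rCoeff_zero_right 0) fun _ => rCoeff_zero_left
  have hK0 : Ktilde g 0 = specializedSeries (kCoeff A 0) := by
    rw [Ktilde, K_eq_kCoeff hA (γ := 0) fun r => by simp [gamma_zero]]
  have hconst : MvPowerSeries.constantCoeff (Ktilde g 0) = 1 := by
    rw [hK0, constantCoeff_specializedSeries, kCoeff_zero_right, Rat.cast_one]
  obtain ⟨Q, hQ, hQc, hQR⟩ := exists_solution hg hsymm hint hA hR hR0
  refine ⟨⟨Q, ⟨hQ, hQc⟩, fun Q' h => eq_of_isSolution_of_converges hg h.1 h.2 hQ hQc⟩,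
    MvPowerSeries.isUnit_iff_constantCoeff.mpr (hconst ▸ isUnit_one), fun Q' hQ' hQc' s => ?_⟩
  obtain rfl := eq_of_isSolution_of_converges hg hQ' hQc' hQ hQc
  rw [hQR, Rtilde, Ktilde, R_eq_rCoeff hA (gamma_single s), K_eq_kCoeff hA (gamma_single s)]
  refine ⟨rfl, ?_⟩
  -- The series of `K` and the constant multiple of the series of `R` solve the same recurrence and
  -- agree at `γ = 0`.
  have hKR := hK.eq_of_zero (hR.const_mul (specializedSeries (kCoeff A 0))) (by rw [hR0, mul_one])
    (minVec s.1 s.2)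
  rw [hKR, ← hK0, mul_right_comm, MvPowerSeries.mul_inv_cancel _ (by simp [hconst]), one_mul]

end Existence

end QSystem

/-! ### Integrality of `t_a (α_a|α_b)` for the simple roots. -/

namespace RootPairing

section Gram

variable {ι M N : Type*} [AddCommGroup M] [Module ℂ M] [AddCommGroup N] [Module ℂ N]
  [Fintype ι] (P : RootPairing ι ℂ M N) [P.IsCrystallographic]

theorem normalizedForm_comm (i j : ι) : P.normalizedForm i j = P.normalizedForm j i := by
  simp only [normalizedForm, canonicalForm, mul_comm]

theorem two_mul_canonicalForm (i j : ι) :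
    2 * P.canonicalForm i j = P.pairingIn ℤ j i * P.canonicalForm i i := by
  have h := P.toInvariantForm.two_mul_apply_root_root j i
  have hp : ((P.pairingIn ℤ j i : ℤ) : ℂ) = P.pairing j i := by
    simpa using P.algebraMap_pairingIn ℤ j i
  rw [toInvariantForm_form, ← canonicalForm_eq_rootForm, ← canonicalForm_eq_rootForm, ← hp] at h
  have hc : P.canonicalForm i j = P.canonicalForm j i := by
    simp only [canonicalForm, mul_comm]
  rw [hc]
  exact_mod_cast h

/-- The normalization cancels, and reflection invariance of the form leaves a Cartan integer. With
symmetry and positivity on the diagonal, this is all that the `Q`-system argument needs from the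
root system. -/
theorem two_div_normalizedForm_mul (i j : ι) :
    2 / P.normalizedForm i i * P.normalizedForm i j = P.pairingIn ℤ j i := by
  have hi := P.normalizedForm_self_pos i
  have h := P.two_mul_canonicalForm i j
  rw [div_mul_eq_mul_div, div_eq_iff hi.ne', normalizedForm, normalizedForm]
  rw [mul_div_assoc', mul_div_assoc', h]
  ring

end Gram

end RootPairing

theorem theorem4p5 {L : Type*} [LieRing L] [LieAlgebra ℂ L] [FiniteDimensional ℂ L]
    [LieAlgebra.IsSimple ℂ L] (H : LieSubalgebra ℂ L) [H.IsCartanSubalgebra]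
    (b : (LieAlgebra.IsKilling.rootSystem H).Base) :
    (∃! Q : b.support × ℕ+ → (MvPowerSeries b.support ℂ)ˣ,
      QSystem.IsSolution b.gram Q ∧ QSystem.Converges Q) ∧
    IsUnit (QSystem.Ktilde b.gram 0) ∧
    ∀ Q : b.support × ℕ+ → (MvPowerSeries b.support ℂ)ˣ,
      QSystem.IsSolution b.gram Q → QSystem.Converges Q →
      ∀ s : b.support × ℕ+,
        (Q s : MvPowerSeries b.support ℂ) = QSystem.Rtilde b.gram (Finsupp.single s 1) ∧
        (Q s : MvPowerSeries b.support ℂ) =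
          QSystem.Ktilde b.gram (Finsupp.single s 1) * (QSystem.Ktilde b.gram 0)⁻¹ :=
  QSystem.existsUnique_solution
    (fun a => RootPairing.normalizedForm_self_pos _ (a : H.root))
    (fun i j => RootPairing.normalizedForm_comm _ (i : H.root) (j : H.root))
    fun i j => ⟨_, (RootPairing.two_div_normalizedForm_mul _ (i : H.root) (j : H.root)).symm⟩
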